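/- **Theorem 3.2 (Tangential recovery).** Let $\mathcal X,\mathcal Y\subset\mathbb R^d$ be compact, let $\mu$ and $\nu$ be Borel probability measures on $\mathcal X$ and $\mathcal Y$, and let $c\in C^1(\mathbb R^d\times\mathbb R^d)$. For $V\in C(\mathcal Y)$ and a Borel map $T:\mathcal X\to\mathcal Y$ put $$\mathcal L(V,T)=\int_{\mathcal X}\bigl(c(x,T(x))-V(T(x))\bigr)\,d\mu(x)+\int_{\mathcal Y}V\,d\nu .$$ Let $\mathcal M\subset\mathbb R^d$ be a compact smooth embedded $m$-dimensional submanifold (without boundary) such that $\mu\ll\mathcal H^m\llcorner\mathcal M$, where $\mathcal H^m$ is the $m$-dimensional Hausdorff measure. Let $(V^*,T_{\mathrm{rec}})$ be an optimal max–min pair, i.e. $$V^*\in\operatorname*{arg\,max}_{V\in C(\mathcal Y)}\ \inf_{T:\mathcal X\to\mathcal Y}\mathcal L(V,T),\qquad T_{\mathrm{rec}}\in\operatorname*{arg\,min}_{T:\mathcal X\to\mathcal Y}\mathcal L(V^*,T),$$ the infimum and the minimum being over Borel maps. Suppose that an optimal Monge map exists, and let $T_{\mathrm{opt}}$ be one: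 a minimizer of $\int_{\mathcal X}c(x,T(x))\,d\mu(x)$ among the Borel maps $T:\mathcal X\to\mathcal Y$ with $T_\#\mu=\nu$. Then for $\mu$-a.e. $x$ one has $x\in\mathcal M$ and $$\Pi_{T_x\mathcal M}\,\nabla_x c\bigl(x,T_{\mathrm{rec}}(x)\bigr)=\Pi_{T_x\mathcal M}\,\nabla_x c\bigl(x,T_{\mathrm{opt}}(x)\bigr),$$ where $\Pi_{T_x\mathcal M}$ is the orthogonal projection of $\mathbb R^d$ onto the tangent space $T_x\mathcal M$. -/

import Mathlib

open MeasureTheory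
open scoped Manifold ContDiff

noncomputable section

namespace SemiDualOT

variable {d : ℕ} {X Y : Set (EuclideanSpace ℝ (Fin d))}

/-- The semi-dual (max--min) objective
`𝓛(V, T) = ∫_X (c(x, T x) - V (T x)) dμ(x) + ∫_Y V(y) dν(y)`. -/
def objective (c : EuclideanSpace ℝ (Fin d) × EuclideanSpace ℝ (Fin d) → ℝ)
    (μ : Measure X) (ν : Measure Y) (V : C(Y, ℝ)) (T : X → Y) : ℝ :=
  (∫ x, (c ((x : EuclideanSpace ℝ (Fin d)), (T x : EuclideanSpace ℝ (Fin d))) - V (T x)) ∂μ)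
    + ∫ y, V y ∂ν

/-- The inner value `inf_T 𝓛(V, T)`, the infimum over all Borel maps `T : X → Y`.
For `X`, `Y` compact, `Y` nonempty, `c` continuous and `μ`, `ν` finite, the infimum is over
a nonempty family of reals that is bounded below, so it is the genuine infimum. -/
def innerValue (c : EuclideanSpace ℝ (Fin d) × EuclideanSpace ℝ (Fin d) → ℝ)
    (μ : Measure X) (ν : Measure Y) (V : C(Y, ℝ)) : ℝ :=
  ⨅ T : {T : X → Y // Measurable T}, objective c μ ν V T.1

/-- `T` is an optimal recovery map for the potential `V`:
`T ∈ argmin_{T : X → Y} 𝓛(V, T)`, over Borel maps. -/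
def IsOptimalRecovery (c : EuclideanSpace ℝ (Fin d) × EuclideanSpace ℝ (Fin d) → ℝ)
    (μ : Measure X) (ν : Measure Y) (V : C(Y, ℝ)) (T : X → Y) : Prop :=
  Measurable T ∧ ∀ S : X → Y, Measurable S → objective c μ ν V T ≤ objective c μ ν V S

/-- `(V, T)` is an optimal solution of the max--min problem `sup_V inf_T 𝓛(V, T)`:
`V ∈ argmax_{V ∈ C(Y)} inf_T 𝓛(V, T)` and `T ∈ argmin_T 𝓛(V, T)`. -/
def IsOptimalPair (c : EuclideanSpace ℝ (Fin d) × EuclideanSpace ℝ (Fin d) → ℝ)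
    (μ : Measure X) (ν : Measure Y) (V : C(Y, ℝ)) (T : X → Y) : Prop :=
  (∀ W : C(Y, ℝ), innerValue c μ ν W ≤ innerValue c μ ν V) ∧ IsOptimalRecovery c μ ν V T

/-- `T` is an optimal transport (Monge) map from `μ` to `ν`: it pushes `μ` forward to `ν` and
minimizes `∫ c(x, T x) dμ(x)` among all Borel maps that push `μ` forward to `ν`. -/
def IsOptimalMongeMap (c : EuclideanSpace ℝ (Fin d) × EuclideanSpace ℝ (Fin d) → ℝ)
    (μ : Measure X) (ν : Measure Y) (T : X → Y) : Prop :=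
  (Measurable T ∧ μ.map T = ν) ∧
    ∀ S : X → Y, Measurable S → μ.map S = ν →
      ∫ x, c ((x : EuclideanSpace ℝ (Fin d)), (T x : EuclideanSpace ℝ (Fin d))) ∂μ ≤
        ∫ x, c ((x : EuclideanSpace ℝ (Fin d)), (S x : EuclideanSpace ℝ (Fin d))) ∂μ

/-- The differential at `x` of the inclusion `M → ℝᵈ` of a submanifold `M ⊆ ℝᵈ` of dimension `m`,
as a linear map from the model tangent space `ℝᵐ` to `ℝᵈ`. -/
def inclusionDeriv {m : ℕ} (M : Set (EuclideanSpace ℝ (Fin d)))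
    [ChartedSpace (EuclideanSpace ℝ (Fin m)) M] (x : M) :
    EuclideanSpace ℝ (Fin m) →L[ℝ] EuclideanSpace ℝ (Fin d) :=
  mfderiv (𝓡 m) 𝓘(ℝ, EuclideanSpace ℝ (Fin d))
    (Subtype.val : M → EuclideanSpace ℝ (Fin d)) x

/-- The tangent space `T_x M` of a submanifold `M ⊆ ℝᵈ`, as a linear subspace of `ℝᵈ`:
the range of the differential at `x` of the inclusion `M → ℝᵈ`. -/
def tangentSubspace {m : ℕ} (M : Set (EuclideanSpace ℝ (Fin d)))
    [ChartedSpace (EuclideanSpace ℝ (Fin m)) M] (x : M) :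
    Submodule ℝ (EuclideanSpace ℝ (Fin d)) :=
  LinearMap.range (inclusionDeriv (m := m) M x).toLinearMap

end SemiDualOT

end

/-! If `m = 0`, the tangent spaces vanish. If `m > 0`, `μ` has no atoms, since Hausdorff measure of
positive dimension has none. For atomless `μ` the Monge infimum equals the Kantorovich minimum
(`exists_transport_map_integral_le`), and by duality (`exists_coupling_integral_le`) the latter is
at most the max–min value. Hence `Topt` also minimizes the inner problem for `V`
(`IsOptimalMongeMap.isOptimalRecovery`), and for a.e. `x` both `Trec x` and `Topt x` minimize `y ↦ c
(x, y) - V y`.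

So `z ↦ c (z, T x) - V (T x)`, for either map `T`, touches the `c`-transform of `V` from above at
`x`. That transform is locally Lipschitz, so by Rademacher's theorem in charts it is differentiable
along `M` at almost every point. There the tangential derivatives of both touching functions equal
its own. -/

/-! ### Atomless measures and their push-forwards. -/

open ProbabilityTheory Set Filter Topology unitInterval in
theorem ProbabilityTheory.continuous_cdf (μ : Measure ℝ) [IsProbabilityMeasure μ]
    [NullSingletonClass μ] : Continuous (cdf μ) := by
  rw [continuous_iff_continuousAt]
  intro x
  rw [(monotone_cdf μ).continuousAt_iff_leftLim_eq_rightLim, StieltjesFunction.rightLim_eq]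
  have h := (cdf μ).measure_singleton x
  rw [measure_cdf, measure_singleton] at h
  have h1 : cdf μ x - Function.leftLim (cdf μ) x ≤ 0 := ENNReal.ofReal_eq_zero.mp h.symm
  have h2 := (monotone_cdf μ).leftLim_le (le_refl x)
  linarith

open ProbabilityTheory Set Filter Topology unitInterval in
/-- The cumulative distribution function of an atomless probability measure pushes it forward to
the uniform measure. -/
theorem ProbabilityTheory.map_cdf_eq_volume (μ : Measure ℝ) [IsProbabilityMeasure μ]
    [NullSingletonClass μ] :
    μ.map (fun x => (⟨cdf μ x, cdf_nonneg μ x, cdf_le_one μ x⟩ : I)) = volume := by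
  have hmeas : Measurable (fun x => (⟨cdf μ x, cdf_nonneg μ x, cdf_le_one μ x⟩ : I)) :=
    (monotone_cdf μ).measurable.subtype_mk
  have : IsProbabilityMeasure (μ.map (fun x => (⟨cdf μ x, cdf_nonneg μ x, cdf_le_one μ x⟩ : I))) :=
    Measure.isProbabilityMeasure_map hmeas.aemeasurable
  have hrange : ∀ t : ℝ, 0 < t → t < 1 → ∃ s, cdf μ s = t := by
    intro t h0 h1
    obtain ⟨a, ha⟩ := ((tendsto_cdf_atBot μ).eventually (eventually_le_nhds h0)).exists
    obtain ⟨b, hb⟩ := ((tendsto_cdf_atTop μ).eventually (eventually_ge_nhds h1)).exists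
    exact mem_range_of_exists_le_of_exists_ge (continuous_cdf μ) ⟨a, ha⟩ ⟨b, hb⟩
  refine Measure.ext_of_Iic _ _ fun t => ?_
  rw [Measure.map_apply hmeas measurableSet_Iic, unitInterval.volume_Iic]
  have hpre : (fun x => (⟨cdf μ x, cdf_nonneg μ x, cdf_le_one μ x⟩ : I)) ⁻¹' Iic t
      = {x | cdf μ x ≤ t} := by
    ext x; rfl
  rw [hpre]
  rcases t.2.2.eq_or_lt with h1 | h1
  · have : {x | cdf μ x ≤ (t : ℝ)} = univ := by
      ext x; simp [h1, cdf_le_one]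
    rw [this, h1]; simp
  · apply le_antisymm
    -- The level set of `t` may be an interval, so the bound is taken at levels `t' > t`, and then
    -- `t'` decreases to `t`.
    · have hle : ∀ t' : ℝ, (t : ℝ) < t' → t' < 1 → μ {x | cdf μ x ≤ (t : ℝ)} ≤ ENNReal.ofReal t' := by
        intro t' ht ht1
        obtain ⟨s, hs⟩ := hrange t' (t.2.1.trans_lt ht) ht1
        rw [← hs, ofReal_cdf]
        refine measure_mono fun x hx => ?_
        by_contra hxs
        have := monotone_cdf μ (not_le.mp hxs).le
        have hx' : cdf μ x ≤ t := hx
        linarith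
      have htend : Tendsto (fun t' : ℝ => ENNReal.ofReal t') (𝓝[>] (t : ℝ))
          (𝓝 (ENNReal.ofReal t)) :=
        (ENNReal.continuous_ofReal.tendsto _).mono_left nhdsWithin_le_nhds
      refine ge_of_tendsto htend ?_
      filter_upwards [Ioo_mem_nhdsGT h1] with t' ht'
      exact hle t' ht'.1 ht'.2
    · rcases t.2.1.eq_or_lt with h0 | h0
      · rw [← h0]; simp
      · obtain ⟨s, hs⟩ := hrange t h0 h1
        rw [← hs, ofReal_cdf]
        exact measure_mono fun x hx => monotone_cdf μ hx

namespace MeasureTheory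

variable {α β : Type*} [MeasurableSpace α] [StandardBorelSpace α] [MeasurableSpace β]
  [StandardBorelSpace β] [Nonempty β]

-- Embed `α` in `ℝ`, apply the cdf to get a uniform variable on `I`, and follow it by a measurable
-- map from `I` that realizes `ρ`.
open ProbabilityTheory unitInterval in
theorem exists_measurable_map_eq_of_isProbabilityMeasure (μ : Measure α) [IsProbabilityMeasure μ]
    [NullSingletonClass μ] (ρ : Measure β) [IsProbabilityMeasure ρ] :
    ∃ φ : α → β, Measurable φ ∧ μ.map φ = ρ := by
  have he := measurableEmbedding_embeddingReal α
  have : IsProbabilityMeasure (μ.map (embeddingReal α)) :=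
    Measure.isProbabilityMeasure_map he.measurable.aemeasurable
  have : NullSingletonClass (μ.map (embeddingReal α)) := by
    refine ⟨fun x => ?_⟩
    rw [Measure.map_apply he.measurable (measurableSet_singleton x)]
    exact (Set.subsingleton_singleton.preimage he.injective).measure_zero μ
  obtain ⟨f, hf, hfρ⟩ := Measure.exists_measurable_map_eq ρ
  have hg : Measurable (fun x => (⟨cdf (μ.map (embeddingReal α)) x, cdf_nonneg _ x,
      cdf_le_one _ x⟩ : I)) := (monotone_cdf _).measurable.subtype_mk
  refine ⟨_, hf.comp (hg.comp he.measurable), ?_⟩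
  rw [← Measure.map_map hf (hg.comp he.measurable), ← Measure.map_map hg he.measurable,
    map_cdf_eq_volume, hfρ]

/-- An atomless finite measure on a standard Borel space can be pushed forward to any measure of
the same mass. -/
theorem exists_measurable_map_eq (μ : Measure α) [IsFiniteMeasure μ]
    [NullSingletonClass μ] (ρ : Measure β) (h : μ Set.univ = ρ Set.univ) :
    ∃ φ : α → β, Measurable φ ∧ μ.map φ = ρ := by
  rcases eq_or_ne (μ Set.univ) 0 with h0 | h0
  · refine ⟨fun _ => Classical.arbitrary β, measurable_const, ?_⟩
    rw [Measure.measure_univ_eq_zero.mp h0, Measure.measure_univ_eq_zero.mp (h.symm.trans h0)]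
    simp
  have ht := measure_ne_top μ Set.univ
  have hμ : IsProbabilityMeasure ((μ Set.univ)⁻¹ • μ) :=
    ⟨by simp [ENNReal.inv_mul_cancel h0 ht]⟩
  have hρ : IsProbabilityMeasure ((μ Set.univ)⁻¹ • ρ) :=
    ⟨by simp [← h, ENNReal.inv_mul_cancel h0 ht]⟩
  have : NullSingletonClass ((μ Set.univ)⁻¹ • μ) := ⟨fun x => by simp⟩
  obtain ⟨φ, hφ, hmap⟩ := exists_measurable_map_eq_of_isProbabilityMeasure
    ((μ Set.univ)⁻¹ • μ) ((μ Set.univ)⁻¹ • ρ)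
  refine ⟨φ, hφ, ?_⟩
  rw [Measure.map_smul] at hmap
  have := congrArg (fun m => (μ Set.univ) • m) hmap
  simpa [smul_smul, ENNReal.mul_inv_cancel h0 ht] using this

/-- An atomless marginal of a coupling `γ` can be mapped onto `γ` while staying in the same cell
of a given countable partition. -/
theorem exists_measurable_map_eq_of_fst (μ : Measure α) [IsFiniteMeasure μ]
    [NullSingletonClass μ] (γ : Measure (α × β)) (h : γ.fst = μ) {p : α → ℕ} (hp : Measurable p) :
    ∃ Φ : α → α × β, Measurable Φ ∧ μ.map Φ = γ ∧ ∀ᵐ x ∂μ, p (Φ x).1 = p x := by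
  rcases isEmpty_or_nonempty α with hα | hα
  · refine ⟨fun a => hα.elim a, measurable_of_empty _, ?_, ?_⟩
    · rw [Measure.eq_zero_of_isEmpty γ, Measure.eq_zero_of_isEmpty μ]; simp
    · rw [Measure.eq_zero_of_isEmpty μ]; simp
  have hpm : ∀ i, MeasurableSet (p ⁻¹' {i}) := fun i => hp (measurableSet_singleton i)
  have hpm' : ∀ i, MeasurableSet (Prod.fst ⁻¹' (p ⁻¹' {i}) : Set (α × β)) :=
    fun i => measurable_fst (hpm i)
  -- Since `γ.fst = μ`, each cell has the same `μ`-mass as the `γ`-mass of the cylinder above it.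
  -- The maps on the cells are then glued.
  have hex : ∀ i, ∃ φ : α → α × β, Measurable φ ∧
      (μ.restrict (p ⁻¹' {i})).map φ = γ.restrict (Prod.fst ⁻¹' (p ⁻¹' {i})) := by
    intro i
    refine exists_measurable_map_eq _ _ ?_
    rw [Measure.restrict_apply_univ, Measure.restrict_apply_univ, ← h, Measure.fst_apply (hpm i)]
  choose φ hφ hmap using hex
  have hΦ : Measurable fun x => φ (p x) x := by
    refine (measurable_from_prod_countable_right (f := fun q : ℕ × α => φ q.1 q.2) ?_).comp
      (hp.prodMk measurable_id)
    exact hφ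
  have hrestr : ∀ i, (μ.restrict (p ⁻¹' {i})).map (fun x => φ (p x) x) =
      γ.restrict (Prod.fst ⁻¹' (p ⁻¹' {i})) := by
    intro i
    rw [← hmap i]
    refine Measure.map_congr ?_
    filter_upwards [ae_restrict_mem (hpm i)] with x hx
    rw [show p x = i from hx]
  have hdisj : Pairwise (Function.onFun Disjoint fun i => p ⁻¹' {i}) := fun i j hij =>
    Disjoint.preimage p (Set.disjoint_singleton.mpr hij)
  have hun : ⋃ i, p ⁻¹' {i} = Set.univ := by ext; simp
  refine ⟨_, hΦ, ?_, ?_⟩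
  · have h1 : μ = Measure.sum fun i => μ.restrict (p ⁻¹' {i}) := by
      rw [← Measure.restrict_iUnion hdisj hpm, hun, Measure.restrict_univ]
    have h2 : γ = Measure.sum fun i => γ.restrict (Prod.fst ⁻¹' (p ⁻¹' {i})) := by
      rw [← Measure.restrict_iUnion (fun i j hij => (hdisj hij).preimage _) hpm',
        ← Set.preimage_iUnion, hun, Set.preimage_univ, Measure.restrict_univ]
    conv_lhs => rw [h1]
    rw [Measure.map_sum hΦ.aemeasurable]
    conv_rhs => rw [h2]
    simp_rw [hrestr]
  · have : ∀ i, ∀ᵐ x ∂μ.restrict (p ⁻¹' {i}), p (φ (p x) x).1 = i := by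
      intro i
      have h3 : ∀ᵐ z ∂γ.restrict (Prod.fst ⁻¹' (p ⁻¹' {i})), p z.1 = i :=
        ae_restrict_mem (hpm' i)
      rw [← hrestr i] at h3
      exact ae_of_ae_map hΦ.aemeasurable h3
    have h4 : ∀ᵐ x ∂μ, ∀ i, x ∈ p ⁻¹' {i} → p (φ (p x) x).1 = i :=
      ae_all_iff.mpr fun i => (ae_restrict_iff' (hpm i)).mp (this i)
    filter_upwards [h4] with x hx
    exact hx (p x) rfl

end MeasureTheory

/-! ### Kantorovich duality by extension of positive functionals. -/

namespace MeasureTheory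

theorem exists_isFiniteMeasure_integral_eq {Z : Type*} [TopologicalSpace Z] [T2Space Z]
    [CompactSpace Z] [MeasurableSpace Z] [BorelSpace Z] (L : C(Z, ℝ) →ₗ[ℝ] ℝ)
    (hL : ∀ h : C(Z, ℝ), (∀ z, 0 ≤ h z) → 0 ≤ L h) :
    ∃ γ : Measure Z, IsFiniteMeasure γ ∧ ∀ h : C(Z, ℝ), ∫ z, h z ∂γ = L h := by
  let Λ : CompactlySupportedContinuousMap Z ℝ →ₚ[ℝ] ℝ :=
  { toFun g := L g.toContinuousMap
    map_add' g g' := L.map_add g.toContinuousMap g'.toContinuousMap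
    map_smul' c g := L.map_smul c g.toContinuousMap
    monotone' g g' hgg' := by
      have h := hL (g'.toContinuousMap - g.toContinuousMap) fun z => sub_nonneg.mpr (hgg' z)
      rw [map_sub] at h
      exact sub_nonneg.mp h }
  refine ⟨RealRMK.rieszMeasure Λ, inferInstance, fun h => ?_⟩
  exact RealRMK.integral_rieszMeasure Λ
    { toFun := h, hasCompactSupport' := HasCompactSupport.of_compactSpace _ }

variable {α β : Type*} [MetricSpace α] [CompactSpace α] [MeasurableSpace α] [BorelSpace α]
  [MetricSpace β] [CompactSpace β] [MeasurableSpace β] [BorelSpace β]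

theorem _root_.ContinuousMap.integrable_of_compactSpace (μ : Measure α) [IsFiniteMeasure μ]
    (φ : C(α, ℝ)) : Integrable φ μ :=
  φ.continuous.integrable_of_hasCompactSupport (HasCompactSupport.of_compactSpace _)

/-- The cone of `(φ, ψ, h, t)` with `t ≤ 0` and `φ ⊕ ψ + h - t c ≥ 0`. -/
def dualityCone (c : C(α × β, ℝ)) :
    PointedCone ℝ (C(α, ℝ) × C(β, ℝ) × C(α × β, ℝ) × ℝ) where
  carrier := {p | p.2.2.2 ≤ 0 ∧
    ∀ x y, 0 ≤ p.1 x + p.2.1 y + p.2.2.1 (x, y) - p.2.2.2 * c (x, y)}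
  zero_mem' := by simp
  smul_mem' := by
    rintro ⟨a, ha⟩ p ⟨h1, h2⟩
    refine ⟨mul_nonpos_of_nonneg_of_nonpos ha h1, fun x y => ?_⟩
    have := mul_nonneg ha (h2 x y)
    change 0 ≤ a * p.1 x + a * p.2.1 y + a * p.2.2.1 (x, y) - (a * p.2.2.2) * c (x, y)
    linarith
  add_mem' := by
    rintro p q ⟨h1, h2⟩ ⟨h3, h4⟩
    refine ⟨add_nonpos h1 h3, fun x y => ?_⟩
    have := add_nonneg (h2 x y) (h4 x y)
    change 0 ≤ (p.1 x + q.1 x) + (p.2.1 y + q.2.1 y) + (p.2.2.1 (x, y) + q.2.2.1 (x, y))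
      - (p.2.2.2 + q.2.2.2) * c (x, y)
    linarith

/-- Integration of a continuous function as a linear functional. -/
noncomputable def integralLinear (μ : Measure α) [IsFiniteMeasure μ] : C(α, ℝ) →ₗ[ℝ] ℝ where
  toFun φ := ∫ x, φ x ∂μ
  map_add' φ ψ := integral_add (φ.integrable_of_compactSpace μ) (ψ.integrable_of_compactSpace μ)
  map_smul' a φ := integral_const_mul a φ

/-- The functional `(φ, ψ, h, t) ↦ ∫ φ dμ + ∫ ψ dν - t D`, defined where `h = 0`. -/
noncomputable def dualityFunctional (μ : Measure α) [IsFiniteMeasure μ] (ν : Measure β)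
    [IsFiniteMeasure ν] (D : ℝ) : (C(α, ℝ) × C(β, ℝ) × C(α × β, ℝ) × ℝ) →ₗ.[ℝ] ℝ where
  domain := LinearMap.ker (LinearMap.fst ℝ C(α × β, ℝ) ℝ ∘ₗ LinearMap.snd ℝ C(β, ℝ) _ ∘ₗ
    LinearMap.snd ℝ C(α, ℝ) _)
  toFun := ((integralLinear μ).coprod ((integralLinear ν).coprod
    ((0 : C(α × β, ℝ) →ₗ[ℝ] ℝ).coprod (LinearMap.toSpanSingleton ℝ ℝ (-D))))).domRestrict _

/-- **Kantorovich duality** on compact metric spaces: if every admissible pair of potentials has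
dual value at most `D`, then some coupling has cost at most `D`. -/
theorem exists_coupling_integral_le (μ : Measure α) [IsProbabilityMeasure μ] (ν : Measure β)
    [IsProbabilityMeasure ν] (c : C(α × β, ℝ)) (D : ℝ)
    (hD : ∀ (φ : C(α, ℝ)) (ψ : C(β, ℝ)), (∀ x y, φ x + ψ y ≤ c (x, y)) →
      ∫ x, φ x ∂μ + ∫ y, ψ y ∂ν ≤ D) :
    ∃ γ : Measure (α × β), IsFiniteMeasure γ ∧ γ.fst = μ ∧ γ.snd = ν ∧ ∫ z, c z ∂γ ≤ D := by
  have hval : ∀ (φ : C(α, ℝ)) (ψ : C(β, ℝ)) (t : ℝ) (h : (φ, ψ, (0 : C(α × β, ℝ)), t) ∈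
      (dualityFunctional μ ν D).domain), dualityFunctional μ ν D ⟨_, h⟩ =
        ∫ x, φ x ∂μ + ∫ y, ψ y ∂ν - t * D := by
    intro φ ψ t h
    change ∫ x, φ x ∂μ + (∫ y, ψ y ∂ν + (0 + t * (-D))) = _
    ring
  have hdom : ∀ (φ : C(α, ℝ)) (ψ : C(β, ℝ)) (t : ℝ), (φ, ψ, (0 : C(α × β, ℝ)), t) ∈
      (dualityFunctional μ ν D).domain := fun φ ψ t => LinearMap.mem_ker.mpr rfl
  have hnonneg : ∀ x : (dualityFunctional μ ν D).domain, x.1 ∈ dualityCone c →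
      0 ≤ dualityFunctional μ ν D x := by
    rintro ⟨⟨φ, ψ, h, t⟩, hx⟩ ⟨ht, hp⟩
    obtain rfl : h = 0 := LinearMap.mem_ker.mp hx
    rw [hval]
    simp only [ContinuousMap.zero_apply, add_zero] at hp ht
    rcases ht.eq_or_lt with rfl | ht
    · simp only [zero_mul, sub_zero] at hp ⊢
      have h1 : ∀ x, 0 ≤ φ x + ∫ y, ψ y ∂ν := fun x => by
        have h2 : 0 ≤ ∫ y, (φ x + ψ y) ∂ν := integral_nonneg (hp x)
        rw [integral_add (integrable_const _) (ψ.integrable_of_compactSpace ν)] at h2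
        simpa using h2
      have h3 : 0 ≤ ∫ x, (φ x + ∫ y, ψ y ∂ν) ∂μ := integral_nonneg h1
      rw [integral_add (φ.integrable_of_compactSpace μ) (integrable_const _)] at h3
      simpa using h3
    -- Dividing by `t < 0` reverses the cone inequality and makes `(t⁻¹ • φ, t⁻¹ • ψ)` an admissible
    -- pair for `hD`.
    · have hinv : ∀ a b : ℝ, t⁻¹ * a ≤ b ↔ t * b ≤ a := fun a b => by
        rw [mul_comm, ← div_eq_mul_inv, div_le_iff_of_neg ht, mul_comm]
      have := hD (t⁻¹ • φ) (t⁻¹ • ψ) fun x y => by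
        have h1 := hp x y
        change t⁻¹ * φ x + t⁻¹ * ψ y ≤ c (x, y)
        rw [← mul_add, hinv]
        linarith
      simp only [ContinuousMap.smul_apply, smul_eq_mul, integral_const_mul] at this
      rw [← mul_add, hinv] at this
      linarith
  -- A large constant added to `φ` absorbs the lower bounds of the three functions, and `-t` cancels
  -- the cost term.
  have hdense : ∀ y, ∃ x : (dualityFunctional μ ν D).domain, x.1 + y ∈ dualityCone c := by
    rintro ⟨φ, ψ, h, t⟩
    obtain ⟨C₁, h1⟩ := (isCompact_range φ.continuous).bddBelow
    obtain ⟨C₂, h2⟩ := (isCompact_range ψ.continuous).bddBelow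
    obtain ⟨C₃, h3⟩ := (isCompact_range h.continuous).bddBelow
    refine ⟨⟨_, hdom (ContinuousMap.const α (-C₁ - C₂ - C₃)) 0 (-t)⟩, ?_, fun x y => ?_⟩
    · change -t + t ≤ 0
      simp
    · have h1 := h1 (Set.mem_range_self x)
      have h2 := h2 (Set.mem_range_self y)
      have h3 := h3 (Set.mem_range_self (x, y))
      change 0 ≤ ((-C₁ - C₂ - C₃) + φ x) + (0 + ψ y) + (0 + h (x, y)) - (-t + t) * c (x, y)
      simp only [neg_add_cancel, zero_mul]
      linarith
  obtain ⟨g, hg, hgs⟩ := riesz_extension (dualityCone c) (dualityFunctional μ ν D) hnonneg hdense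
  have hgval : ∀ (φ : C(α, ℝ)) (ψ : C(β, ℝ)) (t : ℝ), g (φ, ψ, 0, t) =
      ∫ x, φ x ∂μ + ∫ y, ψ y ∂ν - t * D := fun φ ψ t => by
    rw [← hval φ ψ t (hdom φ ψ t)]; exact hg ⟨_, hdom φ ψ t⟩
  let L : C(α × β, ℝ) →ₗ[ℝ] ℝ := g ∘ₗ LinearMap.inr ℝ C(α, ℝ) _ ∘ₗ LinearMap.inr ℝ C(β, ℝ) _ ∘ₗ
    LinearMap.inl ℝ C(α × β, ℝ) ℝ
  have hLdef : ∀ h, L h = g (0, 0, h, 0) := fun h => rfl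
  have hsplit : ∀ φ ψ h t, g (φ, ψ, h, t) = ∫ x, φ x ∂μ + ∫ y, ψ y ∂ν - t * D + L h := by
    intro φ ψ h t
    rw [← hgval, hLdef, ← map_add]
    simp
  have hcone : ∀ (φ : C(α, ℝ)) (ψ : C(β, ℝ)) (h : C(α × β, ℝ)) (t : ℝ), t ≤ 0 →
      (∀ x y, 0 ≤ φ x + ψ y + h (x, y) - t * c (x, y)) →
      0 ≤ ∫ x, φ x ∂μ + ∫ y, ψ y ∂ν - t * D + L h := by
    intro φ ψ h t ht hp
    rw [← hsplit]
    exact hgs _ ⟨ht, hp⟩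
  obtain ⟨γ, hγ, hint⟩ := exists_isFiniteMeasure_integral_eq L fun h hh => by
    simpa using hcone 0 0 h 0 le_rfl (by simpa using fun x y => hh (x, y))
  -- Taking `h = ∓(φ ⊕ ψ)` makes the cone expression vanish, so both signs are allowed. This
  -- equality fixes the marginals of `γ`.
  have hcoup : ∀ (φ : C(α, ℝ)) (ψ : C(β, ℝ)),
      L (φ.comp ContinuousMap.fst + ψ.comp ContinuousMap.snd) = ∫ x, φ x ∂μ + ∫ y, ψ y ∂ν := by
    intro φ ψ
    apply le_antisymm
    · have := hcone φ ψ (-(φ.comp ContinuousMap.fst + ψ.comp ContinuousMap.snd)) 0 le_rfl (by simp)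
      rw [map_neg] at this
      linarith
    · have := hcone (-φ) (-ψ) (φ.comp ContinuousMap.fst + ψ.comp ContinuousMap.snd) 0 le_rfl
        (fun x y => by simp; linarith)
      simp only [ContinuousMap.neg_apply, integral_neg] at this
      linarith
  refine ⟨γ, hγ, ?_, ?_, ?_⟩
  · refine ext_of_forall_integral_eq_of_IsFiniteMeasure fun f => ?_
    have := hcoup f.toContinuousMap 0
    rw [← hint] at this
    simp only [ContinuousMap.add_apply, ContinuousMap.comp_apply, ContinuousMap.zero_apply,
      integral_zero, add_zero] at this
    rw [Measure.fst, integral_map measurable_fst.aemeasurable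
      f.continuous.aestronglyMeasurable]
    exact this
  · refine ext_of_forall_integral_eq_of_IsFiniteMeasure fun f => ?_
    have := hcoup 0 f.toContinuousMap
    rw [← hint] at this
    simp only [ContinuousMap.add_apply, ContinuousMap.comp_apply, ContinuousMap.zero_apply,
      integral_zero, zero_add] at this
    rw [Measure.snd, integral_map measurable_snd.aemeasurable
      f.continuous.aestronglyMeasurable]
    exact this
  · rw [hint]
    -- The element `(0, 0, -c, -1)` lies in the cone, and positivity on it reads `L c ≤ D`.
    have := hcone 0 0 (-c) (-1) (by norm_num) (fun x y => by simp)
    simp only [ContinuousMap.zero_apply, integral_zero, map_neg] at this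
    linarith

end MeasureTheory

/-! ### Near-optimal transport maps and pointwise minimization. -/

namespace MeasureTheory

variable {α β : Type*} [MetricSpace α] [CompactSpace α] [MeasurableSpace α] [BorelSpace α]
  [MetricSpace β] [CompactSpace β] [MeasurableSpace β] [BorelSpace β]

theorem _root_.ContinuousMap.integrable_graph (h : C(α × β, ℝ)) (μ : Measure α) [IsFiniteMeasure μ]
    {T : α → β} (hT : Measurable T) : Integrable (fun x => h (x, T x)) μ := by
  refine Integrable.of_bound
    (h.continuous.measurable.comp (measurable_id.prodMk hT)).aestronglyMeasurable ‖h‖ ?_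
  exact Filter.Eventually.of_forall fun x => h.norm_coe_le_norm _

/-- A coupling with atomless first marginal is approximated in cost by maps that transport
the first marginal to the second. -/
theorem exists_transport_map_integral_le (μ : Measure α) [IsProbabilityMeasure μ]
    [NullSingletonClass μ] (γ : Measure (α × β)) [IsFiniteMeasure γ] (hγ : γ.fst = μ)
    (c : C(α × β, ℝ)) {ε : ℝ} (hε : 0 < ε) :
    ∃ S : α → β, Measurable S ∧ μ.map S = γ.snd ∧ ∫ x, c (x, S x) ∂μ ≤ ∫ z, c z ∂γ + ε := by
  have hα : Nonempty α := μ.nonempty_of_neZero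
  have hβ : Nonempty β := by
    by_contra h
    rw [not_nonempty_iff] at h
    rw [Measure.eq_zero_of_isEmpty γ] at hγ
    apply IsProbabilityMeasure.ne_zero μ
    rw [← hγ, Measure.fst_zero]
  obtain ⟨δ, hδ, hc⟩ := Metric.uniformContinuous_iff.mp
    (CompactSpace.uniformContinuous_of_continuous c.continuous) ε hε
  have hex : ∀ x : α, ∃ n, dist x (TopologicalSpace.denseSeq α n) < δ / 2 := fun x =>
    (TopologicalSpace.denseRange_denseSeq α).exists_dist_lt x (half_pos hδ)
  classical
  -- Points with the same first index lie within `δ` of each other. As `Φ` preserves cells,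
  -- replacing `(Φ x).1` by `x` changes the cost by less than `ε`.
  have hp : Measurable fun x => Nat.find (hex x) :=
    measurable_find hex fun n => measurableSet_lt (by fun_prop) (by fun_prop)
  obtain ⟨Φ, hΦ, hmap, hcell⟩ := exists_measurable_map_eq_of_fst μ γ hγ hp
  refine ⟨fun x => (Φ x).2, hΦ.snd, ?_, ?_⟩
  · rw [Measure.snd, ← hmap, Measure.map_map measurable_snd hΦ]
    rfl
  · have h1 : ∫ z, c z ∂γ = ∫ x, c (Φ x) ∂μ := by
      rw [← hmap, integral_map hΦ.aemeasurable c.continuous.aestronglyMeasurable]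
    have hint : Integrable (fun x => c (Φ x)) μ :=
      Integrable.of_bound (c.continuous.measurable.comp hΦ).aestronglyMeasurable ‖c‖
        (Filter.Eventually.of_forall fun x => c.norm_coe_le_norm _)
    have h2 : ∫ z, c z ∂γ + ε = ∫ x, (c (Φ x) + ε) ∂μ := by
      rw [integral_add hint (integrable_const _), h1]; simp
    rw [h2]
    refine integral_mono_ae (c.integrable_graph μ hΦ.snd) (hint.add (integrable_const _)) ?_
    filter_upwards [hcell] with x hx
    have h3 := Nat.find_spec (hex x)
    have h4 := Nat.find_spec (hex (Φ x).1)
    rw [hx] at h4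
    have h5 : dist (x, (Φ x).2) (Φ x) < δ := by
      rw [Prod.dist_eq, dist_self, max_eq_left dist_nonneg]
      calc dist x (Φ x).1 ≤ _ := dist_triangle_right _ _ _
        _ < δ / 2 + δ / 2 := add_lt_add h3 h4
        _ = δ := add_halves δ
    have h6 := hc h5
    rw [Real.dist_eq] at h6
    have := (abs_lt.mp h6).2
    change c (x, (Φ x).2) ≤ c (Φ x) + ε
    linarith

/-- A measurable map minimizing an integral functional minimizes the integrand almost
everywhere. -/
theorem ae_forall_le_of_forall_integral_le (μ : Measure α) [IsFiniteMeasure μ] (h : C(α × β, ℝ))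
    {T : α → β} (hT : Measurable T)
    (hmin : ∀ S : α → β, Measurable S → ∫ x, h (x, T x) ∂μ ≤ ∫ x, h (x, S x) ∂μ) :
    ∀ᵐ x ∂μ, ∀ y, h (x, T x) ≤ h (x, y) := by
  have hpt : ∀ y, ∀ᵐ x ∂μ, h (x, T x) ≤ h (x, y) := by
    intro y
    have hA : MeasurableSet {x | h (x, y) < h (x, T x)} :=
      measurableSet_lt (h.continuous.measurable.comp (by fun_prop))
        (h.continuous.measurable.comp (by fun_prop))
    classical
    -- This competitor switches to `y` exactly where `y` is strictly better, so minimality makes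
    -- that set null.
    have hS : Measurable fun x => if h (x, y) < h (x, T x) then y else T x :=
      Measurable.ite hA measurable_const hT
    have hle : ∀ x, h (x, if h (x, y) < h (x, T x) then y else T x) =
        min (h (x, y)) (h (x, T x)) := by
      intro x
      split_ifs with hx
      · rw [min_eq_left hx.le]
      · rw [min_eq_right (not_lt.mp hx)]
    have hi : Integrable (fun x => h (x, T x) - h (x, if h (x, y) < h (x, T x) then y else T x)) μ :=
      (h.integrable_graph μ hT).sub (h.integrable_graph μ hS)
    have h0 : ∫ x, (h (x, T x) - h (x, if h (x, y) < h (x, T x) then y else T x)) ∂μ = 0 := by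
      refine le_antisymm ?_ (integral_nonneg fun x => ?_)
      · rw [integral_sub (h.integrable_graph μ hT) (h.integrable_graph μ hS)]
        linarith [hmin _ hS]
      · rw [hle]
        simp
    rw [integral_eq_zero_iff_of_nonneg (fun x => by simp only [hle]; simp) hi] at h0
    filter_upwards [h0] with x hx
    simp only [hle, Pi.zero_apply] at hx
    have := min_le_left (h (x, y)) (h (x, T x))
    linarith
  rcases isEmpty_or_nonempty β with hβ | hβ
  · exact Filter.Eventually.of_forall fun x y => hβ.elim y
  -- A dense sequence and continuity of `h` give one null set that serves all `y`.
  filter_upwards [ae_all_iff.mpr fun n => hpt (TopologicalSpace.denseSeq β n)] with x hx y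
  exact (TopologicalSpace.denseRange_denseSeq β).induction_on y
    (isClosed_le continuous_const (by fun_prop)) hx

end MeasureTheory

/-! ### Optimal Monge maps solve the inner problem. -/

namespace SemiDualOT

variable {d : ℕ} {X Y : Set (EuclideanSpace ℝ (Fin d))}

/-- The restriction of a continuous cost to `X × Y`. -/
def restrictCost (X Y : Set (EuclideanSpace ℝ (Fin d)))
    (c : EuclideanSpace ℝ (Fin d) × EuclideanSpace ℝ (Fin d) → ℝ) (hc : Continuous c) :
    C(X × Y, ℝ) where
  toFun p := c (p.1, p.2)

variable {c : EuclideanSpace ℝ (Fin d) × EuclideanSpace ℝ (Fin d) → ℝ} {μ : Measure X}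
  {ν : Measure Y} [IsProbabilityMeasure μ] {V : C(Y, ℝ)} {T : X → Y}
  [CompactSpace X] [CompactSpace Y]

theorem bddBelow_objective (hc : Continuous c) :
    BddBelow (Set.range fun T : {T : X → Y // Measurable T} => objective c μ ν V T.1) := by
  let h : C(X × Y, ℝ) := restrictCost X Y c hc - V.comp ContinuousMap.snd
  refine ⟨-‖h‖ + ∫ y, V y ∂ν, ?_⟩
  rintro _ ⟨T, rfl⟩
  refine add_le_add_left ?_ _
  have h1 : ∫ _, (-‖h‖) ∂μ ≤ ∫ x, h (x, T.1 x) ∂μ :=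
    integral_mono (integrable_const _) (h.integrable_graph μ T.2) fun x =>
      (abs_le.mp (h.norm_coe_le_norm (x, T.1 x))).1
  rwa [integral_const, probReal_univ, one_smul] at h1

theorem ae_forall_le_of_isOptimalRecovery (hc : Continuous c)
    (hT : IsOptimalRecovery c μ ν V T) :
    ∀ᵐ x : X ∂μ, ∀ y : Y, c (x, T x) - V (T x) ≤ c (x, y) - V y := by
  refine ae_forall_le_of_forall_integral_le μ (restrictCost X Y c hc - V.comp ContinuousMap.snd)
    hT.1 fun S hS => ?_
  exact le_of_add_le_add_right (hT.2 S hS)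

/-- Weak duality: admissibility at `y = T x` bounds the integrand below by `φ`. With `V` maximal,
`innerValue c μ ν V` bounds all dual values. -/
theorem add_integral_le_innerValue [IsProbabilityMeasure ν] (hc : Continuous c) (φ : C(X, ℝ)) (ψ : C(Y, ℝ))
    (h : ∀ (x : X) (y : Y), φ x + ψ y ≤ c (x, y)) :
    ∫ x, φ x ∂μ + ∫ y, ψ y ∂ν ≤ innerValue c μ ν ψ := by
  have hY : Nonempty Y := ν.nonempty_of_neZero
  have : Nonempty {T : X → Y // Measurable T} :=
    ⟨⟨fun _ => Classical.arbitrary Y, measurable_const⟩⟩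
  refine le_ciInf fun T => add_le_add_left ?_ _
  refine integral_mono (φ.integrable_of_compactSpace μ)
    ((restrictCost X Y c hc - ψ.comp ContinuousMap.snd).integrable_graph μ T.2) fun x => ?_
  change φ x ≤ c (x, T.1 x) - ψ (T.1 x)
  linarith [h x (T.1 x)]

/-- For an atomless source measure, an optimal Monge map is an optimal recovery map for every
optimal potential. -/
theorem IsOptimalMongeMap.isOptimalRecovery [IsProbabilityMeasure ν] [NullSingletonClass μ]
    (hc : Continuous c)
    (hV : ∀ W : C(Y, ℝ), innerValue c μ ν W ≤ innerValue c μ ν V)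
    (hT : IsOptimalMongeMap c μ ν T) : IsOptimalRecovery c μ ν V T := by
  obtain ⟨γ, hγ, h1, h2, hcost⟩ := exists_coupling_integral_le μ ν (restrictCost X Y c hc)
    (innerValue c μ ν V) fun φ ψ h => (add_integral_le_innerValue hc φ ψ h).trans (hV ψ)
  have hle : ∫ x : X, c (x, T x) ∂μ ≤ innerValue c μ ν V := by
    refine le_of_forall_pos_le_add fun ε hε => ?_
    obtain ⟨S, hS, hmap, hSc⟩ :=
      exists_transport_map_integral_le μ γ h1 (restrictCost X Y c hc) hε
    exact (hT.2 S hS (hmap.trans h2)).trans (hSc.trans (add_le_add_left hcost ε))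
  -- The potential terms cancel because `T` pushes `μ` to `ν`.
  have hobj : objective c μ ν V T = ∫ x : X, c (x, T x) ∂μ := by
    have h3 : ∫ y, V y ∂ν = ∫ x, V (T x) ∂μ := by
      rw [← hT.1.2, integral_map hT.1.1.aemeasurable V.continuous.aestronglyMeasurable]
    have h4 : ∫ x : X, (c (x, T x) - V (T x)) ∂μ = ∫ x : X, c (x, T x) ∂μ - ∫ x, V (T x) ∂μ :=
      integral_sub ((restrictCost X Y c hc).integrable_graph μ hT.1.1)
        ((V.comp ContinuousMap.snd : C(X × Y, ℝ)).integrable_graph μ hT.1.1)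
    rw [objective, h3, h4, sub_add_cancel]
  exact ⟨hT.1.1, fun S hS => hobj.le.trans (hle.trans (ciInf_le (bddBelow_objective hc) ⟨S, hS⟩))⟩

end SemiDualOT

/-! ### Tangential differentiability of the `c`-transform. -/

namespace SemiDualOT

open Topology

variable {d : ℕ} {Y : Set (EuclideanSpace ℝ (Fin d))}

/-- The `c`-transform `z ↦ inf_y (c(z, y) - V y)` of a potential, on the whole space. -/
noncomputable def cTransform (c : EuclideanSpace ℝ (Fin d) × EuclideanSpace ℝ (Fin d) → ℝ)
    (V : C(Y, ℝ)) (z : EuclideanSpace ℝ (Fin d)) : ℝ :=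
  ⨅ y : Y, (c (z, y) - V y)

section cTransform

variable {c : EuclideanSpace ℝ (Fin d) × EuclideanSpace ℝ (Fin d) → ℝ} [CompactSpace Y]

theorem bddBelow_cTransform (hc : Continuous c) (V : C(Y, ℝ)) (z : EuclideanSpace ℝ (Fin d)) :
    BddBelow (Set.range fun y : Y => c (z, y) - V y) :=
  (isCompact_range (by fun_prop)).bddBelow

theorem cTransform_le (hc : Continuous c) (V : C(Y, ℝ)) (z : EuclideanSpace ℝ (Fin d)) (y : Y) :
    cTransform c V z ≤ c (z, y) - V y :=
  ciInf_le (bddBelow_cTransform hc V z) y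

/-- On a ball times the compact `Y` the `C¹` cost has a single Lipschitz constant, which an infimum
over `y` inherits. -/
theorem locallyLipschitz_cTransform [Nonempty Y] (hc : ContDiff ℝ 1 c) (V : C(Y, ℝ)) :
    LocallyLipschitz (cTransform c V) := by
  intro z₀
  have hK : IsCompact (Metric.closedBall z₀ 1 ×ˢ Y) :=
    (isCompact_closedBall z₀ 1).prod (isCompact_iff_compactSpace.mpr inferInstance)
  obtain ⟨K, hLip⟩ := (hc.locallyLipschitz.locallyLipschitzOn).exists_lipschitzOnWith_of_compact hK
  refine ⟨K, Metric.closedBall z₀ 1, Metric.closedBall_mem_nhds z₀ one_pos, ?_⟩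
  refine LipschitzOnWith.of_le_add_mul K fun z hz w hw => ?_
  rw [← sub_le_iff_le_add]
  refine le_ciInf fun y => ?_
  have h1 := hLip.dist_le_mul (z, (y : EuclideanSpace ℝ (Fin d))) ⟨hz, y.2⟩ (w, y) ⟨hw, y.2⟩
  rw [Prod.dist_eq, dist_self, max_eq_left dist_nonneg, Real.dist_eq] at h1
  have h2 := cTransform_le hc.continuous V z y
  linarith [(abs_le.mp h1).2]

end cTransform

variable {m : ℕ} (M : Set (EuclideanSpace ℝ (Fin d))) [ChartedSpace (EuclideanSpace ℝ (Fin m)) M]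

/-- All differentiable functions that touch `f` from above at `x` have the same derivative along
the tangent space of `M`. -/
def HasUniqueTangentialSupport (f : EuclideanSpace ℝ (Fin d) → ℝ) (x : M) : Prop :=
  ∀ g₁ g₂ : EuclideanSpace ℝ (Fin d) → ℝ, DifferentiableAt ℝ g₁ x → DifferentiableAt ℝ g₂ x →
    (∀ z, f z ≤ g₁ z) → (∀ z, f z ≤ g₂ z) → f x = g₁ x → f x = g₂ x →
    ∀ v ∈ tangentSubspace (m := m) M x, fderiv ℝ g₁ x v = fderiv ℝ g₂ x v

variable [IsManifold (𝓡 m) ∞ M]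

theorem contDiffAt_val_comp_chartAt_symm
    (hM : ContMDiff (𝓡 m) 𝓘(ℝ, EuclideanSpace ℝ (Fin d)) ∞
      (Subtype.val : M → EuclideanSpace ℝ (Fin d))) (x₀ : M) {u : EuclideanSpace ℝ (Fin m)}
    (hu : u ∈ (chartAt (EuclideanSpace ℝ (Fin m)) x₀).target) :
    ContDiffAt ℝ ∞ (fun u => ((chartAt (EuclideanSpace ℝ (Fin m)) x₀).symm u :
      EuclideanSpace ℝ (Fin d))) u := by
  rw [← contMDiffAt_iff_contDiffAt]
  have h := (contMDiffOn_chart_symm (I := 𝓡 m) (n := ∞) (x := x₀)).contMDiffAt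
    ((chartAt (EuclideanSpace ℝ (Fin m)) x₀).open_target.mem_nhds hu)
  exact (hM _).comp u h

/-- Near `x` the inclusion is the chart followed by the parametrization; the chain rule factors its
differential. -/
theorem tangentSubspace_le_range_fderiv
    (hM : ContMDiff (𝓡 m) 𝓘(ℝ, EuclideanSpace ℝ (Fin d)) ∞
      (Subtype.val : M → EuclideanSpace ℝ (Fin d))) (x₀ x : M)
    (hx : x ∈ (chartAt (EuclideanSpace ℝ (Fin m)) x₀).source) {v : EuclideanSpace ℝ (Fin d)}
    (hv : v ∈ tangentSubspace (m := m) M x) :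
    ∃ w, fderiv ℝ (fun u => ((chartAt (EuclideanSpace ℝ (Fin m)) x₀).symm u :
      EuclideanSpace ℝ (Fin d))) (chartAt (EuclideanSpace ℝ (Fin m)) x₀ x) w = v := by
  obtain ⟨w, rfl⟩ := hv
  set e := chartAt (EuclideanSpace ℝ (Fin m)) x₀
  have hex : e x ∈ e.target := e.map_source hx
  have h1 : MDifferentiableAt (𝓡 m) 𝓘(ℝ, EuclideanSpace ℝ (Fin m)) e x :=
    ((contMDiffOn_chart (I := 𝓡 m) (n := ∞) (x := x₀)).contMDiffAt
      (e.open_source.mem_nhds hx)).mdifferentiableAt (by simp)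
  have h2 : DifferentiableAt ℝ (fun u => (e.symm u : EuclideanSpace ℝ (Fin d))) (e x) :=
    (contDiffAt_val_comp_chartAt_symm M hM x₀ hex).differentiableAt (by simp)
  have h3 := h2.hasFDerivAt.hasMFDerivAt.comp x h1.hasMFDerivAt
  have h4 : ((fun u => (e.symm u : EuclideanSpace ℝ (Fin d))) ∘ e) =ᶠ[𝓝 x]
      (Subtype.val : M → EuclideanSpace ℝ (Fin d)) := by
    filter_upwards [e.open_source.mem_nhds hx] with z hz
    simp [e.left_inv hz]
  have h5 := (h3.congr_of_eventuallyEq h4.symm).mfderiv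
  refine ⟨mfderiv (𝓡 m) 𝓘(ℝ, EuclideanSpace ℝ (Fin m)) e x w, ?_⟩
  rw [inclusionDeriv, h5]
  rfl

theorem hasUniqueTangentialSupport_of_differentiableAt
    (hM : ContMDiff (𝓡 m) 𝓘(ℝ, EuclideanSpace ℝ (Fin d)) ∞
      (Subtype.val : M → EuclideanSpace ℝ (Fin d))) (f : EuclideanSpace ℝ (Fin d) → ℝ) (x₀ x : M)
    (hx : x ∈ (chartAt (EuclideanSpace ℝ (Fin m)) x₀).source)
    (hf : DifferentiableAt ℝ (fun u => f ((chartAt (EuclideanSpace ℝ (Fin m)) x₀).symm u))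
      (chartAt (EuclideanSpace ℝ (Fin m)) x₀ x)) :
    HasUniqueTangentialSupport (m := m) M f x := by
  have key : ∀ g : EuclideanSpace ℝ (Fin d) → ℝ, DifferentiableAt ℝ g x → (∀ z, f z ≤ g z) →
      f x = g x → ∀ w, fderiv ℝ g x (fderiv ℝ (fun u =>
        ((chartAt (EuclideanSpace ℝ (Fin m)) x₀).symm u : EuclideanSpace ℝ (Fin d)))
        (chartAt (EuclideanSpace ℝ (Fin m)) x₀ x) w) =
      fderiv ℝ (fun u => f ((chartAt (EuclideanSpace ℝ (Fin m)) x₀).symm u))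
        (chartAt (EuclideanSpace ℝ (Fin m)) x₀ x) w := by
    intro g hg hfg heq w
    set e := chartAt (EuclideanSpace ℝ (Fin m)) x₀
    have hex : e x ∈ e.target := e.map_source hx
    have hψ : DifferentiableAt ℝ (fun u => (e.symm u : EuclideanSpace ℝ (Fin d))) (e x) :=
      (contDiffAt_val_comp_chartAt_symm M hM x₀ hex).differentiableAt (by simp)
    have hval : ((e.symm (e x) : M) : EuclideanSpace ℝ (Fin d)) = x := by rw [e.left_inv hx]
    have hg' : HasFDerivAt g (fderiv ℝ g x) ((e.symm (e x) : M) : EuclideanSpace ℝ (Fin d)) := by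
      rw [hval]; exact hg.hasFDerivAt
    -- The first-order condition at this minimum expresses `fderiv ℝ g x` on the range of the
    -- parametrization's derivative through `f` alone.
    have hmin : IsLocalMin (fun u => g (e.symm u) - f (e.symm u)) (e x) := by
      refine Filter.Eventually.of_forall fun u => ?_
      simp only [hval, heq, sub_self]
      exact sub_nonneg.mpr (hfg _)
    have hd := hmin.hasFDerivAt_eq_zero ((hg'.comp (e x) hψ.hasFDerivAt).sub hf.hasFDerivAt)
    have := congrArg (fun A => A w) hd
    exact sub_eq_zero.mp this
  intro g₁ g₂ h1 h2 hf1 hf2 he1 he2 v hv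
  obtain ⟨w, rfl⟩ := tangentSubspace_le_range_fderiv M hM x₀ x hx hv
  rw [key g₁ h1 hf1 he1, key g₂ h2 hf2 he2]

/-- A locally Lipschitz function has a unique tangential support at almost every point of a
submanifold. -/
theorem hausdorffMeasure_not_hasUniqueTangentialSupport
    (hM : ContMDiff (𝓡 m) 𝓘(ℝ, EuclideanSpace ℝ (Fin d)) ∞
      (Subtype.val : M → EuclideanSpace ℝ (Fin d))) {f : EuclideanSpace ℝ (Fin d) → ℝ}
    (hf : LocallyLipschitz f) :
    Measure.hausdorffMeasure (m : ℝ)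
      (Subtype.val '' {x : M | ¬ HasUniqueTangentialSupport (m := m) M f x}) = 0 := by
  refine measure_null_of_locally_null _ ?_
  rintro _ ⟨x₀, hx₀, rfl⟩
  let e := chartAt (EuclideanSpace ℝ (Fin m)) x₀
  let ψ : EuclideanSpace ℝ (Fin m) → EuclideanSpace ℝ (Fin d) := fun u => e.symm u
  have hxs : x₀ ∈ e.source := mem_chart_source _ x₀
  have hψ : ContDiffAt ℝ ∞ ψ (e x₀) :=
    contDiffAt_val_comp_chartAt_symm M hM x₀ (e.map_source hxs)
  have hψx : ψ (e x₀) = x₀ := by simp [ψ, e.left_inv hxs]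
  obtain ⟨K, t, ht, hLip⟩ := (hψ.of_le (m := 1) (by simp)).exists_lipschitzOnWith
  obtain ⟨K', t', ht', hLip'⟩ := hf (ψ (e x₀))
  have hs : t ∩ ψ ⁻¹' t' ∈ 𝓝 (e x₀) := Filter.inter_mem ht (hψ.continuousAt.preimage_mem_nhds ht')
  obtain ⟨s, hst, hso, hsx⟩ := mem_nhds_iff.mp hs
  have hcomp : LipschitzOnWith (K' * K) (f ∘ ψ) s :=
    hLip'.comp (hLip.mono fun u hu => (hst hu).1) fun u hu => (hst hu).2
  let N := {u | u ∈ s ∧ ¬ DifferentiableAt ℝ (f ∘ ψ) u}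
  -- On `ℝᵐ` the `m`-dimensional Hausdorff measure is a Haar measure, so Rademacher's theorem
  -- applies to it; the Lipschitz parametrization then keeps the image null.
  have hN : Measure.hausdorffMeasure (m : ℝ) N = 0 := by
    have : (Measure.hausdorffMeasure (m : ℝ) : Measure (EuclideanSpace ℝ (Fin m))).IsAddHaarMeasure := by
      have := MeasureTheory.isAddHaarMeasure_hausdorffMeasure (E := EuclideanSpace ℝ (Fin m))
      rwa [finrank_euclideanSpace_fin] at this
    have hae := hcomp.ae_differentiableWithinAt_of_mem (μ := Measure.hausdorffMeasure (m : ℝ))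
    refine measure_mono_null ?_ (ae_iff.mp hae)
    intro u hu hd
    exact hu.2 ((hd hu.1).differentiableAt (hso.mem_nhds hu.1))
  have hN' : Measure.hausdorffMeasure (m : ℝ) (ψ '' N) = 0 := by
    have h := (hLip.mono fun u (hu : u ∈ N) => (hst hu.1).1).hausdorffMeasure_image_le
      (Nat.cast_nonneg m)
    rw [hN, mul_zero] at h
    exact le_antisymm h zero_le
  refine ⟨ψ '' N, ?_, hN'⟩
  have hnhds : Subtype.val '' (e.source ∩ e ⁻¹' s) ∈ 𝓝[M] (x₀ : EuclideanSpace ℝ (Fin d)) := by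
    rw [← map_nhds_subtype_val]
    exact Filter.image_mem_map (Filter.inter_mem (e.open_source.mem_nhds hxs)
      ((e.continuousAt hxs).preimage_mem_nhds (hso.mem_nhds hsx)))
  have hsub : Subtype.val '' {x : M | ¬ HasUniqueTangentialSupport (m := m) M f x} ⊆ M := by
    rintro _ ⟨x, -, rfl⟩; exact x.2
  filter_upwards [nhdsWithin_mono _ hsub hnhds, self_mem_nhdsWithin]
  rintro _ ⟨x, ⟨hx, hxs'⟩, rfl⟩ ⟨x', hx', heq⟩
  obtain rfl := Subtype.ext heq
  refine ⟨e x', ⟨hxs', fun hd => hx' ?_⟩, by simp [ψ, e.left_inv hx]⟩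
  exact hasUniqueTangentialSupport_of_differentiableAt M hM f x₀ x' hx hd

end SemiDualOT

/-! ### Projected gradients and the conclusion. -/

namespace SemiDualOT

theorem starProjection_gradient_eq {E : Type*} [NormedAddCommGroup E] [InnerProductSpace ℝ E]
    [CompleteSpace E] (K : Submodule ℝ E) [K.HasOrthogonalProjection] {g₁ g₂ : E → ℝ} {x : E}
    (h : ∀ v ∈ K, fderiv ℝ g₁ x v = fderiv ℝ g₂ x v) :
    K.starProjection (gradient g₁ x) = K.starProjection (gradient g₂ x) := by
  rw [← sub_eq_zero, ← map_sub, Submodule.starProjection_apply_eq_zero_iff,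
    Submodule.mem_orthogonal']
  intro v hv
  rw [inner_sub_left, gradient, gradient, InnerProductSpace.toDual_symm_apply,
    InnerProductSpace.toDual_symm_apply, h v hv, sub_self]

theorem nullSingletonClass_of_map_absolutelyContinuous {E : Type*} [EMetricSpace E]
    [MeasurableSpace E] [BorelSpace E] {X M : Set E} {μ : Measure X} {m : ℝ} (hm : 0 < m)
    (hμ : μ.map (Subtype.val : X → E) ≪ (Measure.hausdorffMeasure m).restrict M) :
    NullSingletonClass μ := by
  have := Measure.nullSingletonClass_hausdorff (X := E) hm
  refine ⟨fun x => ?_⟩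
  have h := hμ (measure_singleton (x : E))
  rw [Measure.map_apply measurable_subtype_coe (measurableSet_singleton _)] at h
  refine measure_mono_null ?_ h
  rintro _ rfl
  rfl

theorem eq_zero_of_mem_tangentSubspace_of_dim_zero {d : ℕ} (M : Set (EuclideanSpace ℝ (Fin d)))
    [ChartedSpace (EuclideanSpace ℝ (Fin 0)) M] (x : M) {v : EuclideanSpace ℝ (Fin d)}
    (hv : v ∈ tangentSubspace (m := 0) M x) : v = 0 := by
  obtain ⟨w, rfl⟩ := hv
  rw [Subsingleton.elim w 0, map_zero]

end SemiDualOT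

theorem theorem3p2 {d m : ℕ}
    (X Y : Set (EuclideanSpace ℝ (Fin d))) (hX : IsCompact X) (hY : IsCompact Y)
    (μ : Measure X) [IsProbabilityMeasure μ] (ν : Measure Y) [IsProbabilityMeasure ν]
    (c : EuclideanSpace ℝ (Fin d) × EuclideanSpace ℝ (Fin d) → ℝ) (hc : ContDiff ℝ 1 c)
    (M : Set (EuclideanSpace ℝ (Fin d))) (hM : IsCompact M)
    [ChartedSpace (EuclideanSpace ℝ (Fin m)) M] [IsManifold (𝓡 m) ∞ M]
    (hemb : Manifold.IsSmoothEmbedding (𝓡 m) 𝓘(ℝ, EuclideanSpace ℝ (Fin d)) ∞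
      (Subtype.val : M → EuclideanSpace ℝ (Fin d)))
    (hμ : μ.map (Subtype.val : X → EuclideanSpace ℝ (Fin d)) ≪
      (Measure.hausdorffMeasure (m : ℝ)).restrict M)
    (V : C(Y, ℝ)) (Trec : X → Y) (hrec : SemiDualOT.IsOptimalPair c μ ν V Trec)
    (Topt : X → Y) (hopt : SemiDualOT.IsOptimalMongeMap c μ ν Topt) :
    ∀ᵐ x : X ∂μ, ∃ hx : (x : EuclideanSpace ℝ (Fin d)) ∈ M,
      (SemiDualOT.tangentSubspace (m := m) M ⟨x, hx⟩).starProjection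
          (gradient (fun z => c (z, (Trec x : EuclideanSpace ℝ (Fin d)))) x) =
        (SemiDualOT.tangentSubspace (m := m) M ⟨x, hx⟩).starProjection
          (gradient (fun z => c (z, (Topt x : EuclideanSpace ℝ (Fin d)))) x) := by
  have : CompactSpace X := isCompact_iff_compactSpace.mp hX
  have : CompactSpace Y := isCompact_iff_compactSpace.mp hY
  have : Nonempty Y := ν.nonempty_of_neZero
  have hmem : ∀ᵐ x : X ∂μ, (x : EuclideanSpace ℝ (Fin d)) ∈ M :=
    ae_of_ae_map measurable_subtype_coe.aemeasurable (hμ.ae_le (ae_restrict_mem hM.measurableSet))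
  -- For `m = 0` the measure `μ` may have atoms, but both projections are zero.
  rcases Nat.eq_zero_or_pos m with rfl | hm
  · filter_upwards [hmem] with x hx
    refine ⟨hx, SemiDualOT.starProjection_gradient_eq _ fun v hv => ?_⟩
    rw [SemiDualOT.eq_zero_of_mem_tangentSubspace_of_dim_zero M _ hv, map_zero, map_zero]
  have := SemiDualOT.nullSingletonClass_of_map_absolutelyContinuous (Nat.cast_pos.mpr hm) hμ
  have hunique : ∀ᵐ x : X ∂μ, (x : EuclideanSpace ℝ (Fin d)) ∉ Subtype.val ''
      {x : M | ¬ SemiDualOT.HasUniqueTangentialSupport (m := m) M (SemiDualOT.cTransform c V) x} :=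
    ae_of_ae_map measurable_subtype_coe.aemeasurable (hμ.ae_le (ae_restrict_of_ae
      (measure_eq_zero_iff_ae_notMem.mp
        (SemiDualOT.hausdorffMeasure_not_hasUniqueTangentialSupport M hemb.contMDiff
          (SemiDualOT.locallyLipschitz_cTransform hc V)))))
  have hcont := hc.continuous
  filter_upwards [hmem, hunique, SemiDualOT.ae_forall_le_of_isOptimalRecovery hcont hrec.2,
    SemiDualOT.ae_forall_le_of_isOptimalRecovery hcont (hopt.isOptimalRecovery hcont hrec.1)]
    with x hx hxu h1 h2
  refine ⟨hx, SemiDualOT.starProjection_gradient_eq _ fun v hv => ?_⟩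
  have hsupp : SemiDualOT.HasUniqueTangentialSupport (m := m) M (SemiDualOT.cTransform c V)
      ⟨x, hx⟩ := by
    by_contra h
    exact hxu ⟨_, h, rfl⟩
  have hdiff : ∀ y : Y, Differentiable ℝ fun z : EuclideanSpace ℝ (Fin d) => c (z, y) := fun y =>
    (hc.differentiable one_ne_zero).comp (by fun_prop)
  have heq : ∀ y₀ : Y, (∀ y : Y, c (x, y₀) - V y₀ ≤ c (x, y) - V y) →
      SemiDualOT.cTransform c V x = c (x, y₀) - V y₀ := fun y₀ h =>
    le_antisymm (SemiDualOT.cTransform_le hcont V x y₀) (le_ciInf h)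
  -- The points `Trec x` and `Topt x` are frozen here; only `z` varies, so no regularity of the maps
  -- enters.
  have hder := hsupp (fun z => c (z, Trec x) - V (Trec x)) (fun z => c (z, Topt x) - V (Topt x))
    ((hdiff _ _).sub_const _) ((hdiff _ _).sub_const _)
    (fun z => SemiDualOT.cTransform_le hcont V z _) (fun z => SemiDualOT.cTransform_le hcont V z _)
    (heq _ h1) (heq _ h2) v hv
  rwa [fderiv_sub_const, fderiv_sub_const] at hder
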